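/- Let $T\in\mathbb{R}^{n\times n}$ be a transition matrix (non-negative entries, every row sum equal to $1$) which is totally non-negative (every minor of $T$ is non-negative) and satisfies $\det T\neq 0$ (hence $\det T>0$). Then $T$ has a time-inhomogeneous generator over every time interval $[t-\tau,t]$, $t\in\mathbb{R}$, $\tau>0$. That is, there are (i) a continuous matrix-valued function $s\mapsto Q(s)$ on $[t-\tau,t]$ such that every $Q(s)$ has non-negative off-diagonal entries and zero row sums, and (ii) transition matrices $P(s,u)$, $t-\tau\le s\le u\le t$, with $P(s,s)=\mathbf 1$ and $P(s,v)=P(s,u)P(u,v)$ for $s\le u\le v$, which solve the master equation $$\frac{\partial}{\partial u}P(s,u)=P(s,u)\,Q(u),\qquad \frac{\partial}{\partial s}P(s,u)=-Q(s)\,P(s,u)$$ (derivatives one-sided at the ends of the parameter intervals), such that $P(t-\tau,t)=T$. -/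

import Mathlib

/-- A real square matrix is totally non-negative if all its minors are non-negative: every square
submatrix formed by the rows `r 0 < r 1 < …` and the columns `c 0 < c 1 < …` has a non-negative
determinant. -/
def Matrix.IsTotallyNonneg {n : ℕ} (T : Matrix (Fin n) (Fin n) ℝ) : Prop :=
  ∀ (k : ℕ) (r c : Fin k ↪o Fin n), 0 ≤ (T.submatrix r c).det

/-- A (Markov) generator matrix: non-negative off-diagonal entries and zero row sums. -/
def Matrix.IsMarkovGenerator {n : ℕ} (Q : Matrix (Fin n) (Fin n) ℝ) : Prop :=
  (∀ i j, i ≠ j → 0 ≤ Q i j) ∧ ∀ i, ∑ j, Q i j = 0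

/-- `P s u`, for `a ≤ s ≤ u ≤ b`, is the family of transition matrices (from time `s` to time `u`)
of a time-continuous Markov process on the states `Fin n`, whose transition rates at time `s` are
the entries of the generator matrix `Q s`. Rows are indexed by the state at the earlier time.

With `T(t, τ) = P (t - τ) t`, the field `backward` is the equation
`d T(t, τ) / dτ = Q (t - τ) * T(t, τ)`, and `refl` is its initial condition `T(t, 0) = 1`;
the field `forward` is the equation in the later time. Derivatives at the ends of the time interval
are one-sided. -/
structure IsMarkovEvolution {n : ℕ} (Q : ℝ → Matrix (Fin n) (Fin n) ℝ)
    (P : ℝ → ℝ → Matrix (Fin n) (Fin n) ℝ) (a b : ℝ) : Prop where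
  /-- each `Q s` is a generator matrix -/
  generator : ∀ s ∈ Set.Icc a b, (Q s).IsMarkovGenerator
  /-- the transition rates depend continuously on time -/
  continuousOn : ContinuousOn Q (Set.Icc a b)
  /-- each `P s u` has non-negative entries and row sums one -/
  stochastic : ∀ s u, a ≤ s → s ≤ u → u ≤ b → P s u ∈ Matrix.rowStochastic ℝ (Fin n)
  /-- nothing happens in a time interval of length zero -/
  refl : ∀ s ∈ Set.Icc a b, P s s = 1
  /-- the Chapman-Kolmogorov equation (Markov property) -/
  comp : ∀ s u v, a ≤ s → s ≤ u → u ≤ v → v ≤ b → P s v = P s u * P u v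
  /-- the master equation in the later time -/
  forward : ∀ s u, a ≤ s → s ≤ u → u ≤ b → ∀ i j,
    HasDerivWithinAt (fun v => P s v i j) ((P s u * Q u) i j) (Set.Icc s b) u
  /-- the master equation in the earlier time -/
  backward : ∀ s u, a ≤ s → s ≤ u → u ≤ b → ∀ i j,
    HasDerivWithinAt (fun v => P v u i j) (-(Q s * P s u) i j) (Set.Icc a u) s

/-- `Q` is a time-inhomogeneous generator of the transition matrix `T` over the time interval
`[a, b]`: a time-continuous Markov process with generator `Q` has the transition matrix `T` from
time `a` to time `b`. -/
def IsInhomogeneousGenerator {n : ℕ} (Q : ℝ → Matrix (Fin n) (Fin n) ℝ)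
    (T : Matrix (Fin n) (Fin n) ℝ) (a b : ℝ) : Prop :=
  ∃ P : ℝ → ℝ → Matrix (Fin n) (Fin n) ℝ, IsMarkovEvolution Q P a b ∧ P a b = T

/-! The elementary transition matrices 1 + (1 - c)(E_ij - E_ii), with i ≠ j and 0 < c ≤ 1, are
matrix exponentials of generators, so each can be reached by a stochastic flow. Such flows can be
run one after another, so it suffices to write T as a product of these jumps.

The factorisation is Neville elimination made stochastic (`IsTotallyNonneg.exists_eq_jump_mul`).
Subtracting a multiple a of a row from the next one, so as to kill the lowest non-zero entry of the
first column that has one below the diagonal, preserves total non-negativity. This is Whitney's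
reduction (`IsTotallyNonneg.updateRow_sub_smul`), the hard step. The changed row stays non-negative
and, by invertibility, non-zero, so its sum 1 - a is positive and it can be rescaled to sum 1.
Undoing both operations is exactly one jump. Zeros of T stay zeros and a new one appears, so
induction on the number of non-zero entries ends at a diagonal transition matrix, which is 1.
Entries above the diagonal are handled by reversing the order of the states.

For the gluing, each jump is traversed with a smooth speed that vanishes at the ends of its time
interval, so the concatenated rates are continuous. A flow is stored as X and its inverse Y, and
P(s, u) = Y(s) X(u). -/

open Function in
theorem StrictMono.update_of_forall_lt {α β : Type*} [LinearOrder α] [Preorder β] {r : α → β}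
    (hr : StrictMono r) (q : α) (z : β) (h₁ : ∀ i < q, r i < z) (h₂ : ∀ i, q < i → z < r i) :
    StrictMono (update r q z) := by
  intro a b hab
  by_cases ha : a = q
  · subst ha
    rw [update_self, update_of_ne hab.ne']
    exact h₂ b hab
  by_cases hb : b = q
  · subst hb
    rw [update_self, update_of_ne ha]
    exact h₁ a hab
  rw [update_of_ne ha, update_of_ne hb]
  exact hr hab

/-! ### Determinant identities -/

namespace Matrix

theorem det_updateRow_eq_sum {ι R : Type*} [Fintype ι] [DecidableEq ι] [CommRing R]
    (M : Matrix ι ι R) (i : ι) {κ : Type*} [Fintype κ] (a : κ → R) (v : κ → ι → R) :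
    (M.updateRow i (∑ k, a k • v k)).det = ∑ k, a k * (M.updateRow i (v k)).det := by
  have := map_sum ((detRowAlternating (R := R) (n := ι)).toMultilinearMap.toLinearMap M i)
    (fun k => a k • v k) Finset.univ
  simp only [map_smul, smul_eq_mul] at this
  exact this

/-- The three-term Plücker relation. -/
theorem det_updateRow_plucker {ι R : Type*} [Fintype ι] [DecidableEq ι] [CommRing R]
    (N : Matrix ι ι R) {i₀ i₁ : ι} (h : i₀ ≠ i₁) (e p x y : ι → R) :
    ((N.updateRow i₀ p).updateRow i₁ x).det * ((N.updateRow i₀ e).updateRow i₁ y).det =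
      ((N.updateRow i₀ y).updateRow i₁ x).det * ((N.updateRow i₀ e).updateRow i₁ p).det +
      ((N.updateRow i₀ p).updateRow i₁ y).det * ((N.updateRow i₀ e).updateRow i₁ x).det := by
  set M := (N.updateRow i₀ p).updateRow i₁ x with hM
  -- Cramer's rule writes `M.det • y` as a combination of the rows of `M`. Substituted into the
  -- second determinant on the left, every row except `p` and `x` gives a repeated row and drops
  -- out.
  have hc : M.det • y = ∑ i, cramer Mᵀ y i • M i := by
    have := mulVec_cramer Mᵀ y
    rw [det_transpose] at this
    rw [← this]
    ext l
    simp [mulVec, dotProduct, mul_comm]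
  rw [← det_updateRow_smul, hc, det_updateRow_eq_sum _ _ (cramer Mᵀ y) (fun i => M i)]
  rw [← Finset.sum_subset (Finset.subset_univ {i₀, i₁}), Finset.sum_pair h]
  · simp only [cramer_transpose_apply]
    have h0 : M i₀ = p := by
      rw [hM, updateRow_ne h, updateRow_self]
    have h1 : M i₁ = x := by rw [hM, updateRow_self]
    rw [h0, h1, hM, updateRow_idem, updateRow_comm _ h, updateRow_idem,
      updateRow_comm _ h.symm]
  · intro i _ hi
    simp only [Finset.mem_insert, Finset.mem_singleton, not_or] at hi
    have : M i = (N.updateRow i₀ e) i := by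
      rw [hM, updateRow_ne hi.2, updateRow_ne hi.1, updateRow_ne hi.1]
    rw [this, det_updateRow_eq_zero hi.2, mul_zero]

/-- Laplace expansion along a unit row. The sign does not depend on `v`, so it cancels from a
Plücker relation in which this unit row occurs in every term. -/
theorem det_updateRow_single {k : ℕ} {R : Type*} [CommRing R]
    (N : Matrix (Fin (k + 1)) (Fin (k + 1)) R) {i₀ i₁ : Fin (k + 1)} (h : i₀ ≠ i₁)
    (l : Fin (k + 1)) (v : Fin (k + 1) → R) :
    ((N.updateRow i₀ (Pi.single l 1)).updateRow i₁ v).det =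
      (-1) ^ (i₀ + l : ℕ) *
        ((N.updateRow i₁ v).submatrix i₀.succAbove l.succAbove).det := by
  rw [updateRow_comm _ h, ← adjugate_apply, adjugate_fin_succ_eq_det_submatrix]

/-! ### Total non-negativity and Whitney's reduction -/

variable {n : ℕ} {T : Matrix (Fin n) (Fin n) ℝ}

theorem IsTotallyNonneg.det_submatrix_nonneg (hT : T.IsTotallyNonneg) {k : ℕ}
    {r c : Fin k → Fin n} (hr : StrictMono r) (hc : StrictMono c) :
    0 ≤ (T.submatrix r c).det :=
  hT k (OrderEmbedding.ofStrictMono r hr) (OrderEmbedding.ofStrictMono c hc)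

theorem isTotallyNonneg_of_strictMono
    (h : ∀ (k : ℕ) (r c : Fin k → Fin n), StrictMono r → StrictMono c →
      0 ≤ (T.submatrix r c).det) : T.IsTotallyNonneg :=
  fun k r c => h k r c r.strictMono c.strictMono

theorem IsTotallyNonneg.nonneg (hT : T.IsTotallyNonneg) (i j : Fin n) : 0 ≤ T i j := by
  have := hT.det_submatrix_nonneg (r := fun _ : Fin 1 => i) (c := fun _ => j)
    (Subsingleton.strictMono _) (Subsingleton.strictMono _)
  simpa using this

theorem IsTotallyNonneg.minor_two_nonneg (hT : T.IsTotallyNonneg) {i i' j j' : Fin n}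
    (hi : i < i') (hj : j < j') : T i j' * T i' j ≤ T i j * T i' j' := by
  have := hT.det_submatrix_nonneg (r := ![i, i']) (c := ![j, j'])
    (by simp [hi]) (by simp [hj])
  rw [det_fin_two] at this
  simpa using this

/-- The elementary row operation on an arbitrary submatrix containing both rows. -/
theorem det_submatrix_updateRow_of_mem {ι κ R : Type*} [Fintype κ] [DecidableEq κ]
    [DecidableEq ι] [CommRing R] (T : Matrix ι ι R) {x y : ι} (a : R) {r : κ → ι}
    (hr : Function.Injective r) (c : κ → ι) {i i' : κ} (hi : r i = x) (hi' : r i' = y)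
    (hxy : x ≠ y) :
    ((T.updateRow y (T y - a • T x)).submatrix r c).det = (T.submatrix r c).det := by
  have hne : i' ≠ i := by rintro rfl; exact hxy (hi.symm.trans hi')
  rw [← det_updateRow_add_smul_self (T.submatrix r c) hne (-a)]
  congr 1
  ext b l
  by_cases hb : b = i'
  · subst hb
    simp [hi', hi, updateRow_apply]
    ring
  · have : r b ≠ y := fun h => hb (hr (h.trans hi'.symm))
    simp [updateRow_apply, hb, this]

theorem submatrix_updateRow_of_notMem {ι κ R : Type*} [DecidableEq ι]
    (T : Matrix ι ι R) {y : ι} (v : ι → R) {r : κ → ι} (c : κ → ι) (h : ∀ i, r i ≠ y) :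
    (T.updateRow y v).submatrix r c = T.submatrix r c := by
  ext b l
  simp [updateRow_apply, h]

theorem submatrix_update {ι κ R : Type*} [DecidableEq κ] (T : Matrix ι ι R) (r c : κ → ι)
    (q : κ) (z : ι) :
    T.submatrix (Function.update r q z) c =
      (T.submatrix r c).updateRow q (fun l => T z (c l)) := by
  ext b l
  by_cases h : b = q
  · subst h; simp
  · simp [h]

theorem submatrix_updateRow_of_apply_eq {ι κ R : Type*} [DecidableEq κ] [DecidableEq ι]
    (T : Matrix ι ι R) {y : ι} (v : ι → R) {r : κ → ι} (hr : Function.Injective r) (c : κ → ι)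
    {q : κ} (h : r q = y) :
    (T.updateRow y v).submatrix r c = (T.submatrix r c).updateRow q (fun l => v (c l)) := by
  ext b l
  by_cases hb : b = q
  · subst hb; simp [h]
  · have : r b ≠ y := fun h' => hb (hr (h'.trans h.symm))
    simp [hb, this]

/-- Whitney's reduction: a step of Neville elimination preserves total non-negativity. -/
theorem IsTotallyNonneg.updateRow_sub_smul (hT : T.IsTotallyNonneg) {x y j : Fin n}
    (hxy : (x : ℕ) + 1 = y) (hpos : 0 < T x j) (hbelow : ∀ i, y < i → T i j = 0)
    (hleft : ∀ i l, x ≤ i → l < j → T i l = 0) :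
    (T.updateRow y (T y - (T y j / T x j) • T x)).IsTotallyNonneg := by
  set a := T y j / T x j with ha
  set B := T.updateRow y (T y - a • T x) with hB
  have hltxy : x < y := by rw [Fin.lt_def]; omega
  have hBj : ∀ i, y ≤ i → ∀ l ≤ j, B i l = 0 := by
    intro i hi l hl
    rcases hl.lt_or_eq with hl | rfl
    · by_cases hiy : i = y
      · subst hiy
        simp [hB, hleft i l hltxy.le hl, hleft x l le_rfl hl]
      · rw [hB, updateRow_ne hiy, hleft i l (hltxy.le.trans hi) hl]
    · by_cases hiy : i = y
      · subst hiy
        simp [hB, ha]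
        field_simp
        ring
      · rw [hB, updateRow_ne hiy, hbelow i (lt_of_le_of_ne hi (Ne.symm hiy))]
  -- Induction on the size of the minor. Minors that avoid row `y`, or contain both `x` and `y`,
  -- agree with those of `T`; the case left is `y` without `x`.
  apply isTotallyNonneg_of_strictMono
  intro k
  induction k with
  | zero => intro r c _ _; simp
  | succ k ih =>
  intro r c hr hc
  by_cases hy : ∃ q, r q = y
  swap
  · push Not at hy
    rw [hB, submatrix_updateRow_of_notMem _ _ _ hy]
    exact hT.det_submatrix_nonneg hr hc
  obtain ⟨q, hq⟩ := hy
  by_cases hx : ∃ q, r q = x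
  · obtain ⟨q', hq'⟩ := hx
    rw [hB, det_submatrix_updateRow_of_mem _ _ hr.injective _ hq' hq hltxy.ne]
    exact hT.det_submatrix_nonneg hr hc
  push Not at hx
  have hlow : ∀ i < q, r i < x := by
    intro i hi
    have h1 := hr hi
    have h2 := hx i
    rw [hq] at h1
    rw [Ne, Fin.ext_iff] at h2
    rw [Fin.lt_def] at h1 ⊢
    omega
  have hhigh : ∀ i, q < i → x < r i := fun i hi => hltxy.trans (hq ▸ hr hi)
  have hrx : StrictMono (Function.update r q x) := hr.update_of_forall_lt q x hlow hhigh
  by_cases hq0 : q = 0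
  · subst hq0
    have hry : ∀ i, y ≤ r i := fun i => hq ▸ hr.monotone (Fin.zero_le i)
    by_cases hcj : c 0 ≤ j
    · rw [det_eq_zero_of_column_eq_zero 0 (fun i => hBj _ (hry i) _ hcj)]
    push Not at hcj
    -- Border the minor by row `x` and column `j`. In `B` the new first column is (T x j, 0, …, 0),
    -- so the bordered minor is `T x j` times the original one, and it equals a minor of `T`.
    have hr' : StrictMono (Fin.cons x r : Fin (k + 2) → Fin n) := by
      rw [Fin.strictMono_iff_lt_succ]
      intro i
      cases i using Fin.cases with
      | zero => simpa [hq] using hltxy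
      | succ i =>
        simp only [Fin.cons_succ, ← Fin.succ_castSucc]
        exact hr Fin.castSucc_lt_succ
    have hc' : StrictMono (Fin.cons j c : Fin (k + 2) → Fin n) := by
      rw [Fin.strictMono_iff_lt_succ]
      intro i
      cases i using Fin.cases with
      | zero => simpa using hcj
      | succ i =>
        simp only [Fin.cons_succ, ← Fin.succ_castSucc]
        exact hc Fin.castSucc_lt_succ
    have h := hT.det_submatrix_nonneg hr' hc'
    rw [← det_submatrix_updateRow_of_mem T a hr'.injective _ (i := 0) (i' := 1) (x := x) (y := y)
      rfl hq hltxy.ne, ← hB, det_succ_column_zero, Fin.sum_univ_succ,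
      Finset.sum_eq_zero (fun i _ => ?_)] at h
    · have hBx : B x j = T x j := by rw [hB, updateRow_ne hltxy.ne]
      have e : (B.submatrix (Fin.cons x r : Fin (k + 2) → Fin n) (Fin.cons j c)).submatrix
          (Fin.succAbove 0) Fin.succ = B.submatrix r c := by
        ext b l; simp
      rw [e] at h
      simp only [Fin.val_zero, pow_zero, submatrix_apply, Fin.cons_zero, hBx, one_mul,
        add_zero] at h
      exact nonneg_of_mul_nonneg_right h hpos
    · simp [hBj _ (hry i) j le_rfl]
  -- The row `i₀` just before `q` comes from a row of `T` above `x`. Putting `x` in place of either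
  -- keeps the row indices increasing.
  obtain ⟨i₀, hi₀⟩ : ∃ i₀ : Fin (k + 1), (i₀ : ℕ) + 1 = q := by
    have : (q : ℕ) ≠ 0 := fun h => hq0 (Fin.ext h)
    exact ⟨⟨q - 1, by omega⟩, by simp; omega⟩
  have hlt : i₀ < q := by rw [Fin.lt_def]; omega
  have hne : i₀ ≠ q := hlt.ne
  set N := T.submatrix r c with hN
  set p : Fin (k + 1) → ℝ := fun l => T (r i₀) (c l) with hp
  set vx : Fin (k + 1) → ℝ := fun l => T x (c l) with hvx
  set vy : Fin (k + 1) → ℝ := fun l => B y (c l) with hvy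
  have hNp : N.updateRow i₀ p = N := updateRow_eq_self N i₀
  have hBvy : ∀ l, (T y - a • T x) (c l) = vy l := by intro l; simp [hvy, hB]
  have e1 : ((N.updateRow i₀ p).updateRow q vy).det = (B.submatrix r c).det := by
    rw [hNp, hB, submatrix_updateRow_of_apply_eq _ _ hr.injective _ hq]
    simp only [hBvy]
    rfl
  have e2 : 0 ≤ ((N.updateRow i₀ p).updateRow q vx).det := by
    rw [hNp, hN, hvx, ← submatrix_update]
    exact hT.det_submatrix_nonneg hrx hc
  have e3 : 0 ≤ ((N.updateRow i₀ vx).updateRow q vy).det := by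
    have hs : StrictMono (Function.update r i₀ x) := by
      refine hr.update_of_forall_lt i₀ x (fun i hi => hlow i (hi.trans hlt)) fun i hi => ?_
      refine hltxy.trans_le (hq ▸ hr.monotone ?_)
      rw [Fin.lt_def] at hi
      rw [Fin.le_def]; omega
    have h := hT.det_submatrix_nonneg hs hc
    have h1 : Function.update r i₀ x q = y := by rw [Function.update_of_ne hne.symm, hq]
    rw [← det_submatrix_updateRow_of_mem T a hs.injective _ (i := i₀) (i' := q) (x := x) (y := y)
      (by simp) h1 hltxy.ne,
      submatrix_updateRow_of_apply_eq _ _ hs.injective _ h1, submatrix_update] at h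
    simp only [hBvy] at h
    exact h
  have hswap : ((N.updateRow i₀ vy).updateRow q vx).det =
      -((N.updateRow i₀ vx).updateRow q vy).det := by
    have h := det_permute (Equiv.swap i₀ q) ((N.updateRow i₀ vx).updateRow q vy)
    rw [Equiv.Perm.sign_swap hne, Units.val_neg, Units.val_one, Int.cast_neg, Int.cast_one,
      neg_one_mul] at h
    rw [← h]
    congr 1
    ext b l
    by_cases hb : b = q
    · subst hb
      simp [updateRow_apply, hne]
    by_cases hb' : b = i₀
    · subst hb'
      simp [updateRow_apply, hne]
    simp [updateRow_apply, hb, hb', Equiv.swap_apply_of_ne_of_ne hb' hb]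
  have hsa : StrictMono i₀.succAbove := Fin.strictMono_succAbove i₀
  have m1 : ∀ l : Fin (k + 1), 0 ≤ ((N.updateRow q vx).submatrix i₀.succAbove l.succAbove).det := by
    intro l
    rw [hN, hvx, ← submatrix_update, submatrix_submatrix]
    exact hT.det_submatrix_nonneg (hrx.comp hsa) (hc.comp (Fin.strictMono_succAbove l))
  -- Since `i₀` and `q` are adjacent, moving row `i₀` into place `q` and deleting place `i₀` amounts
  -- to deleting row `q`.
  have m2 : ∀ l : Fin (k + 1), 0 ≤ ((N.updateRow q p).submatrix i₀.succAbove l.succAbove).det := by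
    intro l
    rw [hN, hp, ← submatrix_update, submatrix_submatrix]
    refine hT.det_submatrix_nonneg ?_ (hc.comp (Fin.strictMono_succAbove l))
    intro b b' hbb
    have h1 := hsa hbb
    have h2 : i₀.succAbove b ≠ i₀ := Fin.succAbove_ne i₀ b
    simp only [Function.comp_apply]
    generalize i₀.succAbove b = b₁ at *
    generalize i₀.succAbove b' = b₂ at *
    by_cases hb₂ : b₂ = q
    · subst hb₂
      rw [Function.update_self, Function.update_of_ne h1.ne]
      apply hr
      rw [Ne, Fin.ext_iff] at h2
      rw [Fin.lt_def] at h1 ⊢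
      omega
    · rw [Function.update_of_ne hb₂]
      by_cases hb₁ : b₁ = q
      · subst hb₁
        rw [Function.update_self]
        exact hr (hlt.trans h1)
      · rw [Function.update_of_ne hb₁]
        exact hr h1
  have m3 : ∀ l : Fin (k + 1), 0 ≤ ((N.updateRow q vy).submatrix i₀.succAbove l.succAbove).det := by
    intro l
    have h := ih (r ∘ i₀.succAbove) (c ∘ l.succAbove) (hr.comp hsa)
      (hc.comp (Fin.strictMono_succAbove l))
    rw [← submatrix_submatrix, hB, submatrix_updateRow_of_apply_eq _ _ hr.injective _ hq] at h
    simp only [hBvy] at h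
    exact h
  -- Plücker relation with the rows e_l, p, vx, vy. Every factor other than the wanted minor is
  -- non-negative: all come from `T`, except the one in `m3`, which is a smaller minor of `B`.
  have key : ∀ l : Fin (k + 1), (B.submatrix r c).det *
      ((N.updateRow q vx).submatrix i₀.succAbove l.succAbove).det =
      ((N.updateRow i₀ p).updateRow q vx).det *
        ((N.updateRow q vy).submatrix i₀.succAbove l.succAbove).det +
      ((N.updateRow i₀ vx).updateRow q vy).det *
        ((N.updateRow q p).submatrix i₀.succAbove l.succAbove).det := by
    intro l
    have h := det_updateRow_plucker N hne (Pi.single l 1) p vx vy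
    rw [det_updateRow_single _ hne, det_updateRow_single _ hne, det_updateRow_single _ hne, hswap,
      e1] at h
    have hs : ((-1 : ℝ) ^ (i₀ + l : ℕ)) ≠ 0 := by simp
    apply mul_left_cancel₀ hs
    linear_combination -h
  by_cases hm : ∃ l : Fin (k + 1),
      ((N.updateRow q vx).submatrix i₀.succAbove l.succAbove).det ≠ 0
  · obtain ⟨l, hl⟩ := hm
    refine nonneg_of_mul_nonneg_left (b := _) ?_ ((m1 l).lt_of_ne hl.symm)
    rw [key l]
    exact add_nonneg (mul_nonneg e2 (m3 l)) (mul_nonneg e3 (m2 l))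
  -- With no cofactor to divide by, expansion along row `i₀` makes the minor with `x` in place of
  -- `y` vanish, so subtracting a multiple of row `x` changes nothing.
  · push Not at hm
    have h0 : ((N.updateRow i₀ p).updateRow q vx).det = 0 := by
      have hsum : p = ∑ l, p l • (Pi.single l 1 : Fin (k + 1) → ℝ) := pi_eq_sum_univ' p
      rw [updateRow_comm _ hne, hsum, det_updateRow_eq_sum]
      refine Finset.sum_eq_zero fun l _ => ?_
      rw [← updateRow_comm _ hne, det_updateRow_single _ hne, hm l, mul_zero, mul_zero]
    have h1 : (B.submatrix r c).det = N.det := by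
      rw [← e1, hNp]
      have : vy = (fun l => T y (c l)) + (-a) • vx := by
        ext l; simp [hvy, hB, hvx]; ring
      rw [hNp] at h0
      rw [this, det_updateRow_add, det_updateRow_smul, h0, mul_zero, add_zero]
      congr 1
      rw [← hq]
      exact updateRow_eq_self N q
    rw [h1]
    exact hT.det_submatrix_nonneg hr hc

end Matrix

/-! ### Stochastic paths and jumps -/

open Matrix Filter Set

/-- A path of invertible matrices `X` from `1` to `T` with inverses `Y`, constant outside `[a, b]`,
which is driven by the generators `Q`. -/
structure IsStochasticPath {n : ℕ} (Q X Y : ℝ → Matrix (Fin n) (Fin n) ℝ)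
    (T : Matrix (Fin n) (Fin n) ℝ) (a b : ℝ) : Prop where
  continuous : Continuous Q
  generator : ∀ s, (Q s).IsMarkovGenerator
  eq_zero_of_ge : ∀ s, b ≤ s → Q s = 0
  deriv_right : ∀ s i j, HasDerivAt (fun v => X v i j) ((X s * Q s) i j) s
  deriv_left : ∀ s i j, HasDerivAt (fun v => Y v i j) (-(Q s * Y s) i j) s
  left_inv : ∀ s, Y s * X s = 1
  stochastic : ∀ s u, s ≤ u → Y s * X u ∈ rowStochastic ℝ (Fin n)
  right_of_le : ∀ s, s ≤ a → X s = 1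
  left_of_le : ∀ s, s ≤ a → Y s = 1
  right_of_ge : ∀ s, b ≤ s → X s = T

/-- A matrix is the endpoint of a stochastic path over every time interval. -/
def Matrix.IsPathReachable {n : ℕ} (T : Matrix (Fin n) (Fin n) ℝ) : Prop :=
  ∀ a b : ℝ, a < b → ∃ Q X Y, IsStochasticPath Q X Y T a b

namespace Matrix

variable {n : ℕ}

theorem IsMarkovGenerator.zero : (0 : Matrix (Fin n) (Fin n) ℝ).IsMarkovGenerator :=
  ⟨fun _ _ _ => le_rfl, fun _ => by simp⟩

theorem IsMarkovGenerator.add {Q R : Matrix (Fin n) (Fin n) ℝ} (hQ : Q.IsMarkovGenerator)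
    (hR : R.IsMarkovGenerator) : (Q + R).IsMarkovGenerator :=
  ⟨fun i j h => add_nonneg (hQ.1 i j h) (hR.1 i j h), fun i => by
    simp [Finset.sum_add_distrib, hQ.2, hR.2]⟩

theorem IsMarkovGenerator.smul {Q : Matrix (Fin n) (Fin n) ℝ} (hQ : Q.IsMarkovGenerator)
    {c : ℝ} (hc : 0 ≤ c) : (c • Q).IsMarkovGenerator :=
  ⟨fun i j h => mul_nonneg hc (hQ.1 i j h), fun i => by simp [← Finset.mul_sum, hQ.2]⟩

theorem hasDerivAt_mul_apply {A B : ℝ → Matrix (Fin n) (Fin n) ℝ}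
    {A' B' : Matrix (Fin n) (Fin n) ℝ} {s : ℝ}
    (hA : ∀ i j, HasDerivAt (fun v => A v i j) (A' i j) s)
    (hB : ∀ i j, HasDerivAt (fun v => B v i j) (B' i j) s) (i j : Fin n) :
    HasDerivAt (fun v => (A v * B v) i j) ((A' * B s + A s * B') i j) s := by
  simp only [mul_apply, add_apply, ← Finset.sum_add_distrib]
  exact HasDerivAt.fun_sum fun k _ => (hA i k).mul (hB k j)

theorem isPathReachable_one : (1 : Matrix (Fin n) (Fin n) ℝ).IsPathReachable := fun a b _ =>
  ⟨fun _ => 0, fun _ => 1, fun _ => 1,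
    { continuous := continuous_const
      generator := fun _ => .zero
      eq_zero_of_ge := fun _ _ => rfl
      deriv_right := fun s i j => by simpa using hasDerivAt_const s _
      deriv_left := fun s i j => by simpa using hasDerivAt_const s _
      left_inv := fun _ => by simp
      stochastic := fun _ _ _ => by simp
      right_of_le := fun _ _ => rfl
      left_of_le := fun _ _ => rfl
      right_of_ge := fun _ _ => rfl }⟩

/-- Split the interval at `m`. Before `m` the second path is still 1, after `m` the first generator
is 0, so the product rule yields the summed generator; at `m` both descriptions hold. -/
theorem IsPathReachable.mul {S T : Matrix (Fin n) (Fin n) ℝ} (hS : S.IsPathReachable)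
    (hT : T.IsPathReachable) : (S * T).IsPathReachable := by
  intro a b hab
  obtain ⟨m, ham, hmb⟩ := exists_between hab
  obtain ⟨Q₁, X₁, Y₁, h₁⟩ := hS a m ham
  obtain ⟨Q₂, X₂, Y₂, h₂⟩ := hT m b hmb
  refine ⟨fun s => Q₁ s + Q₂ s, fun s => X₁ s * X₂ s, fun s => Y₂ s * Y₁ s, ?_⟩
  exact
    { continuous := h₁.continuous.add h₂.continuous
      generator := fun s => (h₁.generator s).add (h₂.generator s)
      eq_zero_of_ge := fun s hs => by
        rw [h₁.eq_zero_of_ge s (hmb.le.trans hs), h₂.eq_zero_of_ge s hs, add_zero]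
      deriv_right := fun s i j => by
        convert! hasDerivAt_mul_apply (h₁.deriv_right s) (h₂.deriv_right s) i j using 1
        refine congrFun₂ (?_ : _ = (_ : Matrix _ _ ℝ)) i j
        rcases le_total s m with hs | hs
        · simp only [h₂.right_of_le s hs, mul_one, mul_add, one_mul]
        · simp only [h₁.eq_zero_of_ge s hs, mul_zero, zero_mul, zero_add, mul_assoc]
      deriv_left := fun s i j => by
        convert! hasDerivAt_mul_apply (A' := -(Q₂ s * Y₂ s)) (B' := -(Q₁ s * Y₁ s))
          (h₂.deriv_left s) (h₁.deriv_left s) i j using 1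
        rw [← neg_apply]
        refine congrFun₂ (?_ : _ = (_ : Matrix _ _ ℝ)) i j
        rcases le_total s m with hs | hs
        · simp only [h₂.left_of_le s hs, mul_one, one_mul, add_mul, neg_add_rev, neg_mul]
        · simp only [h₁.eq_zero_of_ge s hs, mul_zero, zero_mul, zero_add, neg_zero, add_zero,
            ← mul_assoc, neg_mul]
      left_inv := fun s => by
        rw [mul_assoc, ← mul_assoc (Y₁ s), h₁.left_inv, one_mul, h₂.left_inv]
      stochastic := fun s u hsu => by
        rw [mul_assoc, ← mul_assoc (Y₁ s)]
        rcases le_total s m with hs | hs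
        · rw [h₂.left_of_le s hs, one_mul]
          refine mul_mem (h₁.stochastic s u hsu) ?_
          simpa [h₂.left_of_le s hs] using h₂.stochastic s u hsu
        · rw [h₁.right_of_ge u (hs.trans hsu), ← h₁.right_of_ge s hs, h₁.left_inv, one_mul]
          exact h₂.stochastic s u hsu
      right_of_le := fun s hs => by
        rw [h₁.right_of_le s hs, h₂.right_of_le s (hs.trans ham.le), one_mul]
      left_of_le := fun s hs => by
        rw [h₁.left_of_le s hs, h₂.left_of_le s (hs.trans ham.le), one_mul]
      right_of_ge := fun s hs => by
        rw [h₁.right_of_ge s (hmb.le.trans hs), h₂.right_of_ge s hs] }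

/-- The transition matrix which jumps from `i` to `j` with probability `1 - c`. -/
def jump (i j : Fin n) (c : ℝ) : Matrix (Fin n) (Fin n) ℝ :=
  1 + (1 - c) • (single i j 1 - single i i 1)

theorem single_sub_mul_self {i j : Fin n} (h : i ≠ j) :
    (single i j (1 : ℝ) - single i i 1) * (single i j 1 - single i i 1) =
      -(single i j (1 : ℝ) - single i i 1) := by
  rw [sub_mul, mul_sub, mul_sub, single_mul_single_of_ne _ _ _ _ h.symm,
    single_mul_single_of_ne _ _ _ _ h.symm, single_mul_single_same, single_mul_single_same]
  simp

/-- With G = E_ij - E_ii, -G is idempotent and the jump is (1 + G) + c(-G): it acts as `c` on the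
range of -G and as 1 on the complement. -/
theorem jump_mul_jump {i j : Fin n} (h : i ≠ j) (c d : ℝ) :
    jump i j c * jump i j d = jump i j (c * d) := by
  simp only [jump, add_mul, mul_add, one_mul, mul_one, smul_mul_smul_comm, single_sub_mul_self h]
  module

theorem jump_one (i j : Fin n) : jump i j 1 = 1 := by simp [jump]

theorem isMarkovGenerator_single_sub {i j : Fin n} :
    (single i j (1 : ℝ) - single i i 1).IsMarkovGenerator := by
  constructor
  · intro k l hkl
    have : single i i (1 : ℝ) k l = 0 := by
      rw [single_apply, if_neg]
      rintro ⟨rfl, rfl⟩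
      exact hkl rfl
    rw [sub_apply, this, sub_zero, single_apply]
    positivity
  · intro k
    by_cases h : i = k <;> simp [single_apply, h, Finset.sum_sub_distrib]

theorem jump_mem_rowStochastic {i j : Fin n} {c : ℝ} (h₀ : 0 ≤ c) (h₁ : c ≤ 1) :
    jump i j c ∈ rowStochastic ℝ (Fin n) := by
  rw [mem_rowStochastic_iff_sum]
  constructor
  · intro k l
    simp only [jump, add_apply, smul_apply, sub_apply, single_apply, one_apply, smul_eq_mul]
    by_cases hk : i = k <;> by_cases hl : j = l <;> by_cases hkl : k = l <;>
      simp_all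
  · intro k
    have := isMarkovGenerator_single_sub (i := i) (j := j).2 k
    simp only [jump, add_apply, smul_apply, Finset.sum_add_distrib, smul_eq_mul, ← Finset.mul_sum,
      this]
    simp [one_apply]

/-- The path is exp(L f(s) G), the jump with parameter exp(-L f(s)), where L = -log c and `f` rises
smoothly from 0 to 1 over the interval. -/
theorem isPathReachable_jump {i j : Fin n} (h : i ≠ j) {c : ℝ} (h₀ : 0 < c) (h₁ : c ≤ 1) :
    (jump i j c).IsPathReachable := by
  intro a b hab
  have hba : 0 < b - a := sub_pos.2 hab
  set f : ℝ → ℝ := fun s => Real.smoothTransition ((s - a) / (b - a)) with hf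
  have hfc : ContDiff ℝ 1 f := Real.smoothTransition.contDiff.comp (by fun_prop)
  have hfd : ∀ s, HasDerivAt f (deriv f s) s := fun s =>
    (hfc.differentiable one_ne_zero s).hasDerivAt
  have hfm : Monotone f := fun s u hsu =>
    Real.smoothTransition.monotone (by gcongr)
  have hfa : ∀ s ≤ a, f s = 0 := fun s hs =>
    Real.smoothTransition.zero_of_nonpos (div_nonpos_of_nonpos_of_nonneg (by linarith) hba.le)
  have hfb : ∀ s, b ≤ s → f s = 1 := fun s hs =>
    Real.smoothTransition.one_of_one_le ((one_le_div hba).2 (by linarith))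
  have hfb' : ∀ s, b ≤ s → deriv f s = 0 := by
    intro s hs
    -- At `b` itself `f` attains its maximum 1, which gives derivative zero there without one-sided
    -- arguments.
    have hmax : IsLocalMax f s := by
      refine Eventually.of_forall fun u => ?_
      rw [hfb s hs]
      exact Real.smoothTransition.le_one _
    exact hmax.deriv_eq_zero
  set L := -Real.log c with hL
  have hL0 : 0 ≤ L := neg_nonneg.2 (Real.log_nonpos h₀.le h₁)
  set G := single i j (1 : ℝ) - single i i 1 with hG
  have hGG : G * G = -G := single_sub_mul_self h
  have hYX : ∀ s u, jump i j (Real.exp (L * f s)) * jump i j (Real.exp (-(L * f u))) =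
      jump i j (Real.exp (L * (f s - f u))) := by
    intro s u
    rw [jump_mul_jump h, ← Real.exp_add]
    ring_nf
  refine ⟨fun s => (L * deriv f s) • G, fun s => jump i j (Real.exp (-(L * f s))),
    fun s => jump i j (Real.exp (L * f s)), ?_⟩
  exact
    { continuous := by
        have := hfc.continuous_deriv le_rfl
        fun_prop
      generator := fun s => isMarkovGenerator_single_sub.smul
        (mul_nonneg hL0 (hfm.deriv_nonneg))
      eq_zero_of_ge := fun s hs => by simp [hfb' s hs]
      deriv_right := fun s k l => by
        have h1 := ((((((hfd s).const_mul L).fun_neg).exp).const_sub 1).mul_const (G k l)).const_add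
          ((1 : Matrix (Fin n) (Fin n) ℝ) k l)
        convert! h1 using 1
        simp only [jump, ← hG, add_mul, one_mul, smul_mul_smul_comm, hGG, add_apply, smul_apply,
          neg_apply, smul_eq_mul]
        ring
      deriv_left := fun s k l => by
        have h1 := (((((hfd s).const_mul L).exp).const_sub 1).mul_const (G k l)).const_add
          ((1 : Matrix (Fin n) (Fin n) ℝ) k l)
        convert! h1 using 1
        simp only [jump, ← hG, mul_add, mul_one, smul_mul_smul_comm, hGG, add_apply, smul_apply,
          neg_apply, smul_eq_mul]
        ring
      left_inv := fun s => by rw [hYX]; simp [jump_one]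
      stochastic := fun s u hsu => by
        rw [hYX]
        refine jump_mem_rowStochastic (Real.exp_pos _).le (Real.exp_le_one_iff.2 ?_)
        exact mul_nonpos_of_nonneg_of_nonpos hL0 (sub_nonpos.2 (hfm hsu))
      right_of_le := fun s hs => by simp [hfa s hs, jump_one]
      left_of_le := fun s hs => by simp [hfa s hs, jump_one]
      right_of_ge := fun s hs => by simp [hfb s hs, hL, Real.exp_log h₀] }

theorem IsPathReachable.exists_isInhomogeneousGenerator {T : Matrix (Fin n) (Fin n) ℝ}
    (hT : T.IsPathReachable) {a b : ℝ} (hab : a < b) :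
    ∃ Q : ℝ → Matrix (Fin n) (Fin n) ℝ, IsInhomogeneousGenerator Q T a b := by
  obtain ⟨Q, X, Y, h⟩ := hT a b hab
  refine ⟨Q, fun s u => Y s * X u, ?_, by
    simp only [h.left_of_le a le_rfl, h.right_of_ge b le_rfl, one_mul]⟩
  exact
    { generator := fun s _ => h.generator s
      continuousOn := h.continuous.continuousOn
      stochastic := fun s u _ hsu _ => h.stochastic s u hsu
      refl := fun s _ => h.left_inv s
      comp := fun s u v _ _ _ _ => by
        rw [mul_assoc, ← mul_assoc (X u), mul_eq_one_comm.1 (h.left_inv u), one_mul]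
      forward := fun s u _ _ _ i j => by
        have := hasDerivAt_mul_apply (A := fun _ => Y s) (A' := 0)
          (fun k l => hasDerivAt_const u _) (h.deriv_right u) i j
        simpa [mul_assoc] using this.hasDerivWithinAt
      backward := fun s u _ _ _ i j => by
        have := hasDerivAt_mul_apply (A' := -(Q s * Y s)) (B := fun _ => X u) (B' := 0)
          (h.deriv_left s) (fun k l => hasDerivAt_const s _) i j
        simpa [mul_assoc] using this.hasDerivWithinAt }

end Matrix

/-! ### Factorisation into jumps -/

namespace Matrix

variable {n : ℕ} {T : Matrix (Fin n) (Fin n) ℝ}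

theorem IsTotallyNonneg.updateRow_smul (hT : T.IsTotallyNonneg) (y : Fin n) {d : ℝ} (hd : 0 ≤ d) :
    (T.updateRow y (d • T y)).IsTotallyNonneg := by
  apply isTotallyNonneg_of_strictMono
  intro k r c hr hc
  by_cases hy : ∃ q, r q = y
  · obtain ⟨q, hq⟩ := hy
    rw [submatrix_updateRow_of_apply_eq _ _ hr.injective _ hq]
    have : (fun l => (d • T y) (c l)) = d • (T.submatrix r c) q := by
      ext l; simp [hq]
    rw [this, det_updateRow_smul, updateRow_eq_self]
    exact mul_nonneg hd (hT.det_submatrix_nonneg hr hc)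
  · push Not at hy
    rw [submatrix_updateRow_of_notMem _ _ _ hy]
    exact hT.det_submatrix_nonneg hr hc

/-- Rows and columns of each minor are reversed together, so the two signs cancel. -/
theorem IsTotallyNonneg.submatrix_rev (hT : T.IsTotallyNonneg) :
    (T.submatrix Fin.rev Fin.rev).IsTotallyNonneg := by
  apply isTotallyNonneg_of_strictMono
  intro k r c hr hc
  rw [← det_submatrix_equiv_self Fin.revPerm]
  refine hT.det_submatrix_nonneg (r := Fin.rev ∘ r ∘ Fin.rev) (c := Fin.rev ∘ c ∘ Fin.rev) ?_ ?_
  · exact Fin.rev_strictAnti.comp (hr.comp_strictAnti Fin.rev_strictAnti)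
  · exact Fin.rev_strictAnti.comp (hc.comp_strictAnti Fin.rev_strictAnti)

theorem submatrix_rev_mem_rowStochastic (hT : T ∈ rowStochastic ℝ (Fin n)) :
    T.submatrix Fin.rev Fin.rev ∈ rowStochastic ℝ (Fin n) := by
  rw [mem_rowStochastic_iff_sum] at hT ⊢
  refine ⟨fun i j => hT.1 _ _, fun i => ?_⟩
  rw [← hT.2 i.rev]
  exact Fintype.sum_equiv Fin.revPerm _ _ fun _ => rfl

theorem jump_submatrix_rev (i j : Fin n) (c : ℝ) :
    (jump i j c).submatrix Fin.rev Fin.rev = jump i.rev j.rev c := by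
  ext k l
  simp [jump, single_apply, one_apply, ← Fin.rev_eq_iff]

theorem jump_mul_apply_of_ne {i j k : Fin n} (h : k ≠ i) (c : ℝ) (l : Fin n) :
    (jump i j c * T) k l = T k l := by
  simp [jump, add_mul, sub_mul, single_mul_apply_of_ne _ _ _ _ _ h]

theorem jump_mul_apply_same (i j : Fin n) (c : ℝ) (l : Fin n) :
    (jump i j c * T) i l = c * T i l + (1 - c) * T j l := by
  simp [jump, add_mul, sub_mul]
  ring

/-- A stochastic step of Neville elimination: `T` is a jump followed by a matrix with fewer
non-zero entries. -/
theorem IsTotallyNonneg.exists_eq_jump_mul (hTN : T.IsTotallyNonneg)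
    (hT : T ∈ rowStochastic ℝ (Fin n)) (hdet : T.det ≠ 0)
    (hlow : ∃ k l, l < k ∧ T k l ≠ 0) :
    ∃ (x y : Fin n) (c : ℝ) (S : Matrix (Fin n) (Fin n) ℝ), y ≠ x ∧ 0 < c ∧ c ≤ 1 ∧
      T = jump y x c * S ∧ S.IsTotallyNonneg ∧ S ∈ rowStochastic ℝ (Fin n) ∧ S.det ≠ 0 ∧
      (∀ k l, T k l = 0 → S k l = 0) ∧ ∃ k l, T k l ≠ 0 ∧ S k l = 0 := by
  obtain ⟨j, ⟨k, hk⟩, hjmin⟩ := wellFounded_lt.has_min {l : Fin n | ∃ k, l < k ∧ T k l ≠ 0}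
    (by obtain ⟨k, l, h⟩ := hlow; exact ⟨l, k, h⟩)
  obtain ⟨y, ⟨hjy, hyj⟩, hymax⟩ := wellFounded_gt.has_min {k : Fin n | j < k ∧ T k j ≠ 0} ⟨k, hk⟩
  have hleft' : ∀ i l, l < i → l < j → T i l = 0 := fun i l hli hlj => by
    by_contra h
    exact hjmin l ⟨i, hli, h⟩ hlj
  have hbelow : ∀ i, y < i → T i j = 0 := fun i hi => by
    by_contra h
    exact hymax i ⟨hjy.trans hi, h⟩ hi
  obtain ⟨x, hxy⟩ : ∃ x : Fin n, (x : ℕ) + 1 = y := by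
    rw [Fin.lt_def] at hjy
    exact ⟨⟨y - 1, by omega⟩, by simp; omega⟩
  have hjx : j ≤ x := by
    rw [Fin.lt_def] at hjy
    rw [Fin.le_def]; omega
  have hltxy : x < y := by rw [Fin.lt_def]; omega
  have hleft : ∀ i l, x ≤ i → l < j → T i l = 0 := fun i l hi hl =>
    hleft' i l (hl.trans_le (hjx.trans hi)) hl
  have hypos : 0 < T y j := (hTN.nonneg y j).lt_of_ne hyj.symm
  -- If the pivot vanished, the 2 × 2 minors on rows `x`, `y` with first column `j` would force the
  -- whole row `x` to be zero.
  have hxpos : 0 < T x j := by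
    refine (hTN.nonneg x j).lt_of_ne fun h => hdet (det_eq_zero_of_row_eq_zero x fun l => ?_)
    rcases lt_trichotomy l j with hl | rfl | hl
    · exact hleft x l le_rfl hl
    · exact h.symm
    · have := hTN.minor_two_nonneg hltxy hl
      rw [← h, zero_mul] at this
      exact le_antisymm (nonpos_of_mul_nonpos_left this hypos) (hTN.nonneg x l)
  have hB := hTN.updateRow_sub_smul hxy hxpos hbelow hleft
  set a := T y j / T x j with ha
  have ha0 : 0 ≤ a := (div_pos hypos hxpos).le
  set B := T.updateRow y (T y - a • T x) with hBdef
  have hBy : ∀ l, B y l = T y l - a * T x l := fun l => by simp [hBdef]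
  have hBne : ∀ k ≠ y, ∀ l, B k l = T k l := fun k hk l => by simp [hBdef, hk]
  have hBdet : B.det = T.det := by
    rw [← det_updateRow_add_smul_self T hltxy.ne' (-a), hBdef, sub_eq_add_neg, neg_smul]
  have hsum : ∑ l, B y l = 1 - a := by
    simp only [hBy, Finset.sum_sub_distrib, ← Finset.mul_sum, sum_row_of_mem_rowStochastic hT,
      mul_one]
  have hc : 0 < 1 - a := by
    rw [← hsum]
    refine (Finset.sum_nonneg fun l _ => hB.nonneg y l).lt_of_ne fun h => hdet ?_
    rw [← hBdet]
    refine det_eq_zero_of_row_eq_zero y fun l => ?_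
    exact (Finset.sum_eq_zero_iff_of_nonneg fun l _ => hB.nonneg y l).1 h.symm l
      (Finset.mem_univ l)
  set S := B.updateRow y ((1 - a)⁻¹ • B y) with hS
  have hSy : ∀ l, S y l = (1 - a)⁻¹ * B y l := fun l => by simp [hS]
  have hSne : ∀ k ≠ y, ∀ l, S k l = T k l := fun k hk l => by simp [hS, hk, hBne k hk]
  have hSN : S.IsTotallyNonneg := hB.updateRow_smul y (inv_pos.2 hc).le
  have hS0 : ∀ k l, B k l = 0 → S k l = 0 := fun k l h => by
    by_cases hk : k = y
    · subst hk; rw [hSy, h, mul_zero]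
    · rw [hSne k hk, ← hBne k hk, h]
  refine ⟨x, y, 1 - a, S, hltxy.ne', hc, by linarith, ?_, hSN, ?_, ?_, ?_, y, j, hyj, ?_⟩
  · ext k l
    by_cases hk : k = y
    · subst hk
      rw [jump_mul_apply_same, hSy, hBy, hSne x hltxy.ne, mul_inv_cancel_left₀ hc.ne']
      ring
    · rw [jump_mul_apply_of_ne hk, hSne k hk]
  · rw [mem_rowStochastic_iff_sum]
    refine ⟨hSN.nonneg, fun k => ?_⟩
    by_cases hk : k = y
    · subst hk
      simp only [hSy, ← Finset.mul_sum, hsum, inv_mul_cancel₀ hc.ne']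
    · simp only [hSne k hk, sum_row_of_mem_rowStochastic hT]
  · rw [hS, det_updateRow_smul, updateRow_eq_self, hBdet]
    exact mul_ne_zero (inv_ne_zero hc.ne') hdet
  · intro k l h
    refine hS0 k l ?_
    -- In row `y` a zero of `T` becomes -a T x l ≤ 0, which non-negativity of `B` forces to be 0:
    -- elimination creates no fill-in.
    by_cases hk : k = y
    · subst hk
      refine le_antisymm ?_ (hB.nonneg k l)
      rw [hBy, h, zero_sub]
      exact neg_nonpos.2 (mul_nonneg ha0 (hTN.nonneg x l))
    · rw [hBne k hk, h]
  · refine hS0 y j ?_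
    rw [hBy, ha, div_mul_cancel₀ _ hxpos.ne', sub_self]

/-- A non-singular totally non-negative transition matrix is a product of jumps. -/
theorem IsTotallyNonneg.mem_closure_jump (hTN : T.IsTotallyNonneg)
    (hT : T ∈ rowStochastic ℝ (Fin n)) (hdet : T.det ≠ 0) :
    T ∈ Submonoid.closure {A : Matrix (Fin n) (Fin n) ℝ |
      ∃ i j c, i ≠ j ∧ 0 < c ∧ c ≤ 1 ∧ A = jump i j c} := by
  classical
  induction hm : (Finset.univ.filter fun p : Fin n × Fin n => T p.1 p.2 ≠ 0).card using
    Nat.strong_induction_on generalizing T with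
  | _ m ih =>
  by_cases h1 : ∀ k l, k ≠ l → T k l = 0
  · have : T = 1 := by
      ext k l
      by_cases hkl : k = l
      · subst hkl
        have := sum_row_of_mem_rowStochastic hT k
        rw [Finset.sum_eq_single k (fun l _ hl => h1 k l hl.symm) (by simp)] at this
        rw [this, one_apply_eq]
      · rw [h1 k l hkl, one_apply_ne hkl]
    rw [this]
    exact one_mem _
  push Not at h1
  suffices h : ∃ (x y : Fin n) (c : ℝ) (S : Matrix (Fin n) (Fin n) ℝ), y ≠ x ∧ 0 < c ∧ c ≤ 1 ∧
      T = jump y x c * S ∧ S.IsTotallyNonneg ∧ S ∈ rowStochastic ℝ (Fin n) ∧ S.det ≠ 0 ∧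
      (∀ k l, T k l = 0 → S k l = 0) ∧ ∃ k l, T k l ≠ 0 ∧ S k l = 0 by
    obtain ⟨x, y, c, S, hyx, hc0, hc1, hTS, hSN, hS, hSdet, hz, k, l, hkl, hkl'⟩ := h
    rw [hTS]
    refine mul_mem (Submonoid.subset_closure ⟨y, x, c, hyx, hc0, hc1, rfl⟩)
      (ih _ ?_ hSN hS hSdet rfl)
    rw [← hm]
    refine Finset.card_lt_card (Finset.ssubset_iff_of_subset (fun p hp => ?_) |>.2 ⟨(k, l), ?_⟩)
    · simp only [Finset.mem_filter, Finset.mem_univ, true_and] at hp ⊢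
      exact fun h => hp (hz _ _ h)
    · simp [hkl, hkl']
  obtain ⟨k, l, hkl, hne⟩ := h1
  rcases hkl.lt_or_gt with hlt | hlt
  -- Only an entry above the diagonal is at hand; reversing the states moves it below, and the
  -- resulting jump is reversed back.
  · obtain ⟨x, y, c, S, hyx, hc0, hc1, hTS, hSN, hS, hSdet, hz, k', l', h, h'⟩ :=
      hTN.submatrix_rev.exists_eq_jump_mul (submatrix_rev_mem_rowStochastic hT)
        (by rwa [show T.submatrix Fin.rev Fin.rev = T.submatrix Fin.revPerm Fin.revPerm from rfl,
          det_submatrix_equiv_self])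
        ⟨k.rev, l.rev, Fin.rev_lt_rev.2 hlt, by simpa using hne⟩
    refine ⟨x.rev, y.rev, c, S.submatrix Fin.rev Fin.rev, by simpa using hyx, hc0, hc1, ?_,
      hSN.submatrix_rev, submatrix_rev_mem_rowStochastic hS, ?_, fun k l h => hz _ _ (by simpa),
      k'.rev, l'.rev, h, by simpa using h'⟩
    · rw [← jump_submatrix_rev]
      have := congrArg (fun A => A.submatrix Fin.revPerm Fin.revPerm) hTS
      rw [← submatrix_mul_equiv _ _ _ Fin.revPerm] at this
      convert! this using 1
      ext; simp
    · rwa [show S.submatrix Fin.rev Fin.rev = S.submatrix Fin.revPerm Fin.revPerm from rfl,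
        det_submatrix_equiv_self]
  · exact hTN.exists_eq_jump_mul hT hdet ⟨k, l, hlt, hne⟩

theorem IsTotallyNonneg.isPathReachable (hTN : T.IsTotallyNonneg)
    (hT : T ∈ rowStochastic ℝ (Fin n)) (hdet : T.det ≠ 0) : T.IsPathReachable := by
  have h := hTN.mem_closure_jump hT hdet
  clear hTN hT hdet
  induction h using Submonoid.closure_induction with
  | mem A hA =>
    obtain ⟨i, j, c, h, h₀, h₁, rfl⟩ := hA
    exact isPathReachable_jump h h₀ h₁
  | one => exact isPathReachable_one
  | mul A B _ _ hA hB => exact hA.mul hB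

end Matrix

theorem mainTheorem5 {n : ℕ} (T : Matrix (Fin n) (Fin n) ℝ)
    (hT : T ∈ Matrix.rowStochastic ℝ (Fin n)) (hTN : T.IsTotallyNonneg) (hdet : T.det ≠ 0)
    (t τ : ℝ) (hτ : 0 < τ) :
    ∃ Q : ℝ → Matrix (Fin n) (Fin n) ℝ, IsInhomogeneousGenerator Q T (t - τ) t :=
  (hTN.isPathReachable hT hdet).exists_isInhomogeneousGenerator (sub_lt_self t hτ)
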